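/- Let $V_4(3,3,4)\subset\mathbb{C}^{3\times3\times4}$ be the set of tensors of border rank at most $4$, i.e. the closure of the set of tensors that are sums of four tensors of the form $a\otimes b\otimes c$. Write $X_1,\dots,X_4$ for the frontal slices $X_k=[x_{i,j,k}]_{i,j=1}^3$ of $\mathcal X=[x_{i,j,k}]$. For $3\times 3$ matrices let $$\Phi(U,V;A,B,C,D)=\sum_{\alpha,\beta,\gamma,\delta\in S_3}\operatorname{sgn}(\alpha\beta\gamma\delta)\,u_{\alpha(1)\gamma(1)}a_{\alpha(2)\gamma(2)}b_{\alpha(3)\delta(2)}\,v_{\beta(1)\delta(1)}c_{\beta(2)\gamma(3)}d_{\beta(3)\delta(3)},$$ and define the ten Landsberg–Manivel (LM) polynomials, a basis of the module $S_{2,2,2}\mathbb{C}^3\otimes S_{2,2,2}\mathbb{C}^3\otimes S_{3,1,1,1}\mathbb{C}^4$ of polynomials of degree six, by $$P_{k,l}(\mathcal X)=-\tfrac1{18}\sum_{\sigma\in S_4}\operatorname{sgn}(\sigma)\,\Phi\bigl(X_k,X_l;X_{\sigma(1)},X_{\sigma(2)},X_{\sigma(3)},X_{\sigma(4)}\bigr),\qquad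 1\le k\le l\le 4.$$ These are ten linearly independent homogeneous polynomials of degree $6$ that vanish on $V_4(3,3,4)$. Consider tensors $\mathcal X\in\mathbb{C}^{3\times3\times4}$ of the block form $$X_k=\begin{bmatrix}x_{1,1,k}&x_{1,2,k}&0\\x_{2,1,k}&x_{2,2,k}&0\\0&0&x_{3,3,k}\end{bmatrix},\qquad k=1,2,3,4,$$ and let $Y_k=\begin{bmatrix}x_{1,1,k}&x_{1,2,k}\\x_{2,1,k}&x_{2,2,k}\end{bmatrix}$ and $f(\mathcal X)=\det\bigl[x_{1,1,k}\ \ x_{1,2,k}\ \ x_{2,1,k}\ \ x_{2,2,k}\bigr]_{k=1}^4$. (1) The restriction of $P_{k,l}$ to the space of tensors of this form (set $x_{1,3,m}=x_{2,3,m}=x_{3,1,m}=x_{3,2,m}=0$ for all $m$) is the polynomial $x_{3,3,k}\,x_{3,3,l}\,f(\mathcal X)$, for all $1\le k\le l\le4$. (2) For a tensor $\mathcal X$ of this form the following are equivalent: (a) $\mathcal X$ has border rank at most $4$; (b) the ten LM polynomials vanish on $\mathcal X$; (c) $x_{3,3,k}\,x_{3,3,l}\,f(\mathcal X)=0$ for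 all $1\le k\le l\le4$; (d) the matrices $Y_1,Y_2,Y_3,Y_4$ are linearly dependent, or $x_{3,3,k}=0$ for all $k=1,2,3,4$. Moreover $Y_1,\dots,Y_4$ are linearly dependent if and only if $f(\mathcal X)=0$. -/

import Mathlib

open MvPolynomial

/-- A complex `m × n × l` tensor `[x_{i,j,k}]`; its `k`-th frontal slice is the matrix
`[x_{i,j,k}]_{i,j}`. -/
abbrev Tensor3 (m n l : ℕ) : Type := Fin m → Fin n → Fin l → ℂ

/-- `X` is a sum of `r` (possibly zero) rank one tensors `a_s ⊗ b_s ⊗ c_s`. -/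
def HasRankLE {m n l : ℕ} (r : ℕ) (X : Tensor3 m n l) : Prop :=
  ∃ (a : Fin r → Fin m → ℂ) (b : Fin r → Fin n → ℂ) (c : Fin r → Fin l → ℂ),
    ∀ i j k, X i j k = ∑ s, a s i * b s j * c s k

/-- The variety `V_r(m,n,l)` of tensors of border rank at most `r`: the closure of the set of
tensors of rank at most `r`. -/
def borderRankVariety (r m n l : ℕ) : Set (Tensor3 m n l) :=
  closure {X | HasRankLE r X}

/-- The coordinate ring `ℂ[x_{i,j,k}]` of `3 × 3 × 4` tensors. -/
abbrev CoordRing334 : Type := MvPolynomial (Fin 3 × Fin 3 × Fin 4) ℂ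

/-- The value of a polynomial at a tensor. -/
noncomputable def evalTensor (X : Tensor3 3 3 4) (P : CoordRing334) : ℂ :=
  eval (fun p => X p.1 p.2.1 p.2.2) P

/-- The `k`-th generic frontal slice, a `3 × 3` matrix of variables. -/
noncomputable def genericSlice (k : Fin 4) : Matrix (Fin 3) (Fin 3) CoordRing334 :=
  Matrix.of fun i j => X (i, j, k)

/-- A six-linear form in `3 × 3` matrices. It contracts the row indices of `U, A, B` and of
`V, C, D`, and the column indices of `U, A, C` and of `V, B, D`, each triple with the alternating
symbol on three letters. It is therefore `SL₃ × SL₃`-invariant. -/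
def sixForm {R : Type*} [CommRing R] (U V A B C D : Matrix (Fin 3) (Fin 3) R) : R :=
  ∑ α : Equiv.Perm (Fin 3), ∑ β : Equiv.Perm (Fin 3),
  ∑ γ : Equiv.Perm (Fin 3), ∑ δ : Equiv.Perm (Fin 3),
    ((α.sign * β.sign * γ.sign * δ.sign : ℤˣ) : ℤ) •
      (U (α 0) (γ 0) * A (α 1) (γ 1) * B (α 2) (δ 1) *
        (V (β 0) (δ 0) * C (β 1) (γ 2) * D (β 2) (δ 2)))

/-- The Landsberg–Manivel polynomials of degree six, a weight basis (`k ≤ l`) of the module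
`S_{2,2,2} ℂ³ ⊗ S_{2,2,2} ℂ³ ⊗ S_{3,1,1,1} ℂ⁴`: the form `sixForm` in the slices `X_k, X_l` and in
all four slices, alternated over the latter. It is symmetric in `k, l`. -/
noncomputable def lmPoly (k l : Fin 4) : CoordRing334 :=
  C (-1 / 18 : ℂ) * ∑ σ : Equiv.Perm (Fin 4), ((σ.sign : ℤˣ) : ℤ) •
    sixForm (genericSlice k) (genericSlice l)
      (genericSlice (σ 0)) (genericSlice (σ 1)) (genericSlice (σ 2)) (genericSlice (σ 3))

/-- All frontal slices are block diagonal with a `2 × 2` block followed by a `1 × 1` block. -/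
def IsBlockTensor (X : Tensor3 3 3 4) : Prop :=
  ∀ k, X 0 2 k = 0 ∧ X 1 2 k = 0 ∧ X 2 0 k = 0 ∧ X 2 1 k = 0

/-- Restriction of a polynomial to the space of block tensors: the variables
`x_{13k}, x_{23k}, x_{31k}, x_{32k}` are set to zero. -/
noncomputable def restrictToBlock : CoordRing334 →ₐ[ℂ] CoordRing334 :=
  aeval fun p => if (p.1 = 2 ↔ p.2.1 = 2) then X p else 0

/-- The `2 × 2` block of the `k`-th frontal slice. -/
def block (T : Tensor3 3 3 4) (k : Fin 4) : Matrix (Fin 2) (Fin 2) ℂ :=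
  !![T 0 0 k, T 0 1 k; T 1 0 k, T 1 1 k]

/-- The `4 × 4` determinant `f` whose `k`-th row lists the entries of the `k`-th `2 × 2` block. -/
noncomputable def blockDet : CoordRing334 :=
  (Matrix.of fun k : Fin 4 =>
    ![(X (0, 0, k) : CoordRing334), X (0, 1, k), X (1, 0, k), X (1, 1, k)]).det

/-! On rank one matrices `sixForm` is a product of four `3 × 3` determinants. If all slices are
combinations of four rank one matrices, alternation in the last four arguments extracts the
determinant of the coefficients. What remains cancels in pairs under a transposition
(`sum_sign_sixForm_vecMulVec`). So the polynomials vanish at rank at most four, and by continuity on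
the closure.

On block tensors, sorting the terms of `sixForm` by the matrices that supply their corner entries
and alternating leaves `-18 * z k * z l * det` (`sum_sign_sixForm_blockMatrix`), whence the factor
`-1/18`. Linear independence is read off from these restrictions.

Conversely, if the corners vanish, four matrix units suffice. If the blocks are dependent, they lie
in a hyperplane of `2 × 2` matrices, which is spanned by three rank one matrices; the corner costs a
fourth. So block tensors of border rank at most four even have rank at most four. -/

/-- The alternating sum of a function of three arguments over all orderings of `0, 1, 2`. -/
def altSum {M : Type*} [AddCommGroup M] (F : Fin 3 → Fin 3 → Fin 3 → M) : M :=
  F 0 1 2 - F 0 2 1 - F 1 0 2 + F 1 2 0 + F 2 0 1 - F 2 1 0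

/-! ### Explicit alternating sums over `S₃` and `S₄` -/

theorem sum_perm_fin_three {M : Type*} [AddCommGroup M] (F : Fin 3 → Fin 3 → Fin 3 → M) :
    ∑ α : Equiv.Perm (Fin 3), ((α.sign : ℤˣ) : ℤ) • F (α 0) (α 1) (α 2) = altSum F := by
  have h : (Finset.univ : Finset (Equiv.Perm (Fin 3))) =
      {1, .swap 1 2, .swap 0 1, .swap 0 1 * .swap 1 2, .swap 0 2 * .swap 1 2, .swap 0 2} := by
    decide
  rw [h]
  repeat rw [Finset.sum_insert (by decide)]
  rw [Finset.sum_singleton]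
  have e : ∀ (α : Equiv.Perm (Fin 3)) (s : ℤ) (i j k : Fin 3), (α.sign : ℤ) = s ∧ α 0 = i ∧
      α 1 = j ∧ α 2 = k → ((α.sign : ℤˣ) : ℤ) • F (α 0) (α 1) (α 2) = s • F i j k := by
    rintro α s i j k ⟨rfl, rfl, rfl, rfl⟩; rfl
  rw [e 1 1 0 1 2 (by decide), e (.swap 1 2) (-1) 0 2 1 (by decide),
    e (.swap 0 1) (-1) 1 0 2 (by decide), e (.swap 0 1 * .swap 1 2) 1 1 2 0 (by decide),
    e (.swap 0 2 * .swap 1 2) 1 2 0 1 (by decide), e (.swap 0 2) (-1) 2 1 0 (by decide)]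
  simp only [one_smul, neg_smul, altSum]
  abel

theorem sum_perm_fin_four {M : Type*} [AddCommGroup M] (F : Fin 4 → Fin 4 → Fin 4 → Fin 4 → M) :
    ∑ σ : Equiv.Perm (Fin 4), ((σ.sign : ℤˣ) : ℤ) • F (σ 0) (σ 1) (σ 2) (σ 3) =
      (F 0 1 2 3 - F 0 1 3 2 - F 0 2 1 3 + F 0 2 3 1 + F 0 3 1 2 - F 0 3 2 1)
      - (F 1 0 2 3 - F 1 0 3 2 - F 1 2 0 3 + F 1 2 3 0 + F 1 3 0 2 - F 1 3 2 0)
      + (F 2 0 1 3 - F 2 0 3 1 - F 2 1 0 3 + F 2 1 3 0 + F 2 3 0 1 - F 2 3 1 0)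
      - (F 3 0 1 2 - F 3 0 2 1 - F 3 1 0 2 + F 3 1 2 0 + F 3 2 0 1 - F 3 2 1 0) := by
  -- Group the permutations by the image `p` of `0`: each is `swap 0 p` after a permutation of the
  -- successors, which costs a sign when `p ≠ 0`.
  have key : ∀ p : Fin 4,
      ∑ τ : Equiv.Perm (Fin 3),
        ((Equiv.Perm.sign (Equiv.Perm.decomposeFin.symm (p, τ)) : ℤˣ) : ℤ) •
        F (Equiv.Perm.decomposeFin.symm (p, τ) 0) (Equiv.Perm.decomposeFin.symm (p, τ) 1)
          (Equiv.Perm.decomposeFin.symm (p, τ) 2) (Equiv.Perm.decomposeFin.symm (p, τ) 3) =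
      (if p = 0 then (1 : ℤ) else -1) • altSum fun i j k =>
        F p (Equiv.swap 0 p i.succ) (Equiv.swap 0 p j.succ) (Equiv.swap 0 p k.succ) := by
    intro p
    rw [← sum_perm_fin_three, Finset.smul_sum]
    refine Finset.sum_congr rfl fun τ _ => ?_
    have e0 := Equiv.Perm.decomposeFin_symm_apply_zero p τ
    have e1 : Equiv.Perm.decomposeFin.symm (p, τ) 1 = Equiv.swap 0 p (τ 0).succ :=
      Equiv.Perm.decomposeFin_symm_apply_succ τ p 0
    have e2 : Equiv.Perm.decomposeFin.symm (p, τ) 2 = Equiv.swap 0 p (τ 1).succ :=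
      Equiv.Perm.decomposeFin_symm_apply_succ τ p 1
    have e3 : Equiv.Perm.decomposeFin.symm (p, τ) 3 = Equiv.swap 0 p (τ 2).succ :=
      Equiv.Perm.decomposeFin_symm_apply_succ τ p 2
    rw [e0, e1, e2, e3, Equiv.Perm.decomposeFin.symm_sign, smul_smul]
    split_ifs <;> simp
  have s0 : ∀ i, Equiv.swap (0 : Fin 4) 0 i = i := by decide
  have s1 : ∀ i, Equiv.swap (0 : Fin 4) 1 i = ![1, 0, 2, 3] i := by decide
  have s2 : ∀ i, Equiv.swap (0 : Fin 4) 2 i = ![2, 1, 0, 3] i := by decide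
  have s3 : ∀ i, Equiv.swap (0 : Fin 4) 3 i = ![3, 1, 2, 0] i := by decide
  rw [← Equiv.Perm.decomposeFin.symm.sum_comp, Fintype.sum_prod_type, Fin.sum_univ_four,
    key, key, key, key]
  simp only [s0, s1, s2, s3, altSum, if_true, if_neg (show (1 : Fin 4) ≠ 0 by decide),
    if_neg (show (2 : Fin 4) ≠ 0 by decide), if_neg (show (3 : Fin 4) ≠ 0 by decide), one_smul,
    neg_smul]
  simp only [Fin.succ_zero_eq_one, Fin.succ_one_eq_two, show (2 : Fin 3).succ = (3 : Fin 4) from rfl,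
    Matrix.cons_val]
  abel

/-! ### The six-linear form on block diagonal matrices -/

/-- The factor of `sixForm` that involves `V, B, C, D`. -/
def fourForm {R : Type*} [CommRing R] (V B C D : Matrix (Fin 3) (Fin 3) R) (p q : Fin 3) : R :=
  altSum fun k k' k'' => B p k' * altSum fun l l' l'' => V l k * C l' q * D l'' k''

/-- Nesting the alternations lets the zeros of a block matrix kill most terms before `fourForm` is
expanded, instead of facing all `6 ^ 4` terms at once. -/
theorem sixForm_eq_altSum {R : Type*} [CommRing R] (U V A B C D : Matrix (Fin 3) (Fin 3) R) :
    sixForm U V A B C D =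
      altSum fun i i' i'' => altSum fun j j' j'' => U i j * A i' j' * fourForm V B C D i'' j'' := by
  simp only [fourForm, ← sum_perm_fin_three]
  unfold sixForm
  refine Finset.sum_congr rfl fun α _ => ?_
  rw [Finset.sum_comm, Finset.smul_sum]
  refine Finset.sum_congr rfl fun γ _ => ?_
  rw [Finset.sum_comm, Finset.mul_sum, Finset.smul_sum, Finset.smul_sum]
  refine Finset.sum_congr rfl fun δ _ => ?_
  simp only [Finset.mul_sum, Finset.smul_sum, zsmul_eq_mul, Units.val_mul, Int.cast_mul]
  refine Finset.sum_congr rfl fun β _ => ?_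
  ring

/-- The block diagonal matrix whose `2 × 2` block has the entries `y`, read row by row, and whose
`1 × 1` block is `z`. -/
def blockMatrix {R : Type*} [CommRing R] (y : Fin 4 → R) (z : R) : Matrix (Fin 3) (Fin 3) R :=
  !![y 0, y 1, 0; y 2, y 3, 0; 0, 0, z]

/-- The contraction of four `2 × 2` matrices with alternating symbols in the rows of `A, B` and of
`C, D` and in the columns of `A, C` and of `B, D`. -/
def cycleForm {R : Type*} [CommRing R] (A B C D : Fin 4 → R) : R :=
  A 0 * (B 2 * (C 1 * D 3 - C 3 * D 1) - B 3 * (C 1 * D 2 - C 3 * D 0))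
  - A 1 * (B 2 * (C 0 * D 3 - C 2 * D 1) - B 3 * (C 0 * D 2 - C 2 * D 0))
  - A 2 * (B 0 * (C 1 * D 3 - C 3 * D 1) - B 1 * (C 1 * D 2 - C 3 * D 0))
  + A 3 * (B 0 * (C 0 * D 3 - C 2 * D 1) - B 1 * (C 0 * D 2 - C 2 * D 0))

/-- The polarisation of the `2 × 2` determinant. -/
def polarDet {R : Type*} [CommRing R] (A B : Fin 4 → R) : R :=
  A 0 * B 3 - A 1 * B 2 - A 2 * B 1 + A 3 * B 0

/-- The index `2` occurs once in each of the two row triples and the two column triples, and a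
corner entry uses it in a row and a column together. The pairs of matrices that can supply the
corners are therefore `UV`, `UD`, `AV`, `AD` and `BC`. -/
theorem sixForm_blockMatrix {R : Type*} [CommRing R] (U V A B C D : Fin 4 → R) (u v a b c d : R) :
    sixForm (blockMatrix U u) (blockMatrix V v) (blockMatrix A a)
      (blockMatrix B b) (blockMatrix C c) (blockMatrix D d) =
      u * v * cycleForm A B C D + u * (d * cycleForm A B C V) + v * (a * cycleForm U B C D)
        + a * d * cycleForm U B C V + b * c * (polarDet U A * polarDet V D) := by
  rw [sixForm_eq_altSum]
  simp only [altSum, blockMatrix, Matrix.of_apply, Matrix.cons_val, mul_zero, zero_mul, add_zero,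
    zero_add, sub_zero, zero_sub]
  simp only [fourForm, altSum, Matrix.of_apply, Matrix.cons_val, mul_zero, zero_mul, add_zero,
    zero_add, sub_zero, zero_sub]
  unfold cycleForm polarDet
  ring

theorem det_fin_four {R : Type*} [CommRing R] (Y : Matrix (Fin 4) (Fin 4) R) :
    Y.det =
      Y 0 0 * (Y 1 1 * (Y 2 2 * Y 3 3 - Y 2 3 * Y 3 2) - Y 1 2 * (Y 2 1 * Y 3 3 - Y 2 3 * Y 3 1)
        + Y 1 3 * (Y 2 1 * Y 3 2 - Y 2 2 * Y 3 1))
      - Y 0 1 * (Y 1 0 * (Y 2 2 * Y 3 3 - Y 2 3 * Y 3 2) - Y 1 2 * (Y 2 0 * Y 3 3 - Y 2 3 * Y 3 0)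
        + Y 1 3 * (Y 2 0 * Y 3 2 - Y 2 2 * Y 3 0))
      + Y 0 2 * (Y 1 0 * (Y 2 1 * Y 3 3 - Y 2 3 * Y 3 1) - Y 1 1 * (Y 2 0 * Y 3 3 - Y 2 3 * Y 3 0)
        + Y 1 3 * (Y 2 0 * Y 3 1 - Y 2 1 * Y 3 0))
      - Y 0 3 * (Y 1 0 * (Y 2 1 * Y 3 2 - Y 2 2 * Y 3 1) - Y 1 1 * (Y 2 0 * Y 3 2 - Y 2 2 * Y 3 0)
        + Y 1 2 * (Y 2 0 * Y 3 1 - Y 2 1 * Y 3 0)) := by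
  have h : Y.det = (Y.transpose).det := (Matrix.det_transpose Y).symm
  rw [h, Matrix.det_apply]
  have := sum_perm_fin_four fun i j k l => Y 0 i * Y 1 j * Y 2 k * Y 3 l
  simp only [Fin.prod_univ_four, Matrix.transpose_apply, Units.smul_def]
  rw [this]
  ring

theorem sum_sign_cycleForm {R : Type*} [CommRing R] (Y : Fin 4 → Fin 4 → R) :
    ∑ σ : Equiv.Perm (Fin 4), ((σ.sign : ℤˣ) : ℤ) •
      cycleForm (Y (σ 0)) (Y (σ 1)) (Y (σ 2)) (Y (σ 3)) = -12 * (Matrix.of Y).det := by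
  rw [sum_perm_fin_four (fun i j k l => cycleForm (Y i) (Y j) (Y k) (Y l)), det_fin_four]
  simp only [cycleForm, Matrix.of_apply]
  ring

/-- Alternating three arguments of `cycleForm` already gives a multiple of the determinant, so with
`Y l` in the fourth slot only `σ 3 = l` contributes. The factor is a quarter of the `-12` of the
full alternation. -/
theorem sum_sign_mul_cycleForm_right {R : Type*} [CommRing R] (Y : Fin 4 → Fin 4 → R)
    (z : Fin 4 → R) (l : Fin 4) :
    ∑ σ : Equiv.Perm (Fin 4), ((σ.sign : ℤˣ) : ℤ) •
      (z (σ 3) * cycleForm (Y (σ 0)) (Y (σ 1)) (Y (σ 2)) (Y l)) =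
        -3 * (z l * (Matrix.of Y).det) := by
  rw [sum_perm_fin_four (fun i j k m => z m * cycleForm (Y i) (Y j) (Y k) (Y l)), det_fin_four]
  simp only [cycleForm, Matrix.of_apply]
  fin_cases l <;> simp only [Fin.zero_eta, Fin.mk_one, Fin.reduceFinMk] <;> ring

theorem sum_sign_mul_cycleForm_left {R : Type*} [CommRing R] (Y : Fin 4 → Fin 4 → R)
    (z : Fin 4 → R) (k : Fin 4) :
    ∑ σ : Equiv.Perm (Fin 4), ((σ.sign : ℤˣ) : ℤ) •
      (z (σ 0) * cycleForm (Y k) (Y (σ 1)) (Y (σ 2)) (Y (σ 3))) =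
        -3 * (z k * (Matrix.of Y).det) := by
  rw [sum_perm_fin_four (fun i j m n => z i * cycleForm (Y k) (Y j) (Y m) (Y n)), det_fin_four]
  simp only [cycleForm, Matrix.of_apply]
  fin_cases k <;> simp only [Fin.zero_eta, Fin.mk_one, Fin.reduceFinMk] <;> ring

theorem sum_sign_sixForm_blockMatrix {R : Type*} [CommRing R] (Y : Fin 4 → Fin 4 → R)
    (z : Fin 4 → R) (k l : Fin 4) :
    ∑ σ : Equiv.Perm (Fin 4), ((σ.sign : ℤˣ) : ℤ) •
      sixForm (blockMatrix (Y k) (z k)) (blockMatrix (Y l) (z l))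
        (blockMatrix (Y (σ 0)) (z (σ 0))) (blockMatrix (Y (σ 1)) (z (σ 1)))
        (blockMatrix (Y (σ 2)) (z (σ 2))) (blockMatrix (Y (σ 3)) (z (σ 3))) =
      -18 * (z k * z l * (Matrix.of Y).det) := by
  -- The summands of `h4` and `h5` cancel in pairs: exchanging two of the alternated slices, in `h5`
  -- those that enter only through `z`, gives the same total with opposite sign.
  have h4 : ∑ σ : Equiv.Perm (Fin 4), ((σ.sign : ℤˣ) : ℤ) •
      (z (σ 0) * z (σ 3) * cycleForm (Y k) (Y (σ 1)) (Y (σ 2)) (Y l)) = 0 := by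
    rw [sum_perm_fin_four (fun i j m n => z i * z n * cycleForm (Y k) (Y j) (Y m) (Y l))]
    ring
  have h5 : ∑ σ : Equiv.Perm (Fin 4), ((σ.sign : ℤˣ) : ℤ) •
      (z (σ 1) * z (σ 2) * (polarDet (Y k) (Y (σ 0)) * polarDet (Y l) (Y (σ 3)))) = 0 := by
    rw [sum_perm_fin_four
      (fun i j m n => z j * z m * (polarDet (Y k) (Y i) * polarDet (Y l) (Y n)))]
    ring
  simp only [sixForm_blockMatrix, smul_add, Finset.sum_add_distrib, h4, h5,
    ← mul_smul_comm _ (z k * z l), ← mul_smul_comm _ (z k), ← mul_smul_comm _ (z l),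
    ← Finset.mul_sum, sum_sign_cycleForm, sum_sign_mul_cycleForm_right, sum_sign_mul_cycleForm_left]
  ring

/-! ### Specialisations of the Landsberg–Manivel polynomials -/

theorem map_sixForm {R S : Type*} [CommRing R] [CommRing S] (f : R →+* S)
    (U V A B C D : Matrix (Fin 3) (Fin 3) R) :
    f (sixForm U V A B C D) =
      sixForm (U.map f) (V.map f) (A.map f) (B.map f) (C.map f) (D.map f) := by
  simp only [sixForm, map_sum, map_zsmul, map_mul, Matrix.map_apply]

theorem isHomogeneous_lmPoly (k l : Fin 4) : (lmPoly k l).IsHomogeneous 6 := by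
  have hz : ∀ (n : ℤ) (P : CoordRing334), P.IsHomogeneous 6 → (n • P).IsHomogeneous 6 := by
    intro n P hP
    rw [zsmul_eq_mul]
    have : ((n : CoordRing334)).IsHomogeneous 0 := by
      rw [← map_intCast (C : ℂ →+* CoordRing334)]
      exact isHomogeneous_C _ _
    simpa using this.mul hP
  have hC := isHomogeneous_C (Fin 3 × Fin 3 × Fin 4) (-1 / 18 : ℂ)
  have hX : ∀ k i j, (genericSlice k i j).IsHomogeneous 1 := fun k i j => isHomogeneous_X _ _
  unfold lmPoly sixForm
  refine (zero_add 6) ▸ hC.mul ?_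
  refine IsHomogeneous.sum _ _ _ fun σ _ => hz _ _ ?_
  refine IsHomogeneous.sum _ _ _ fun α _ => IsHomogeneous.sum _ _ _ fun β _ =>
    IsHomogeneous.sum _ _ _ fun γ _ => IsHomogeneous.sum _ _ _ fun δ _ => hz _ _ ?_
  exact (((hX _ _ _).mul (hX _ _ _)).mul (hX _ _ _)).mul
    (((hX _ _ _).mul (hX _ _ _)).mul (hX _ _ _))

/-- The `k`-th frontal slice. -/
def slice (T : Tensor3 3 3 4) (k : Fin 4) : Matrix (Fin 3) (Fin 3) ℂ :=
  Matrix.of fun i j => T i j k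

theorem evalTensor_lmPoly (T : Tensor3 3 3 4) (k l : Fin 4) :
    evalTensor T (lmPoly k l) = (-1 / 18) * ∑ σ : Equiv.Perm (Fin 4), ((σ.sign : ℤˣ) : ℤ) •
      sixForm (slice T k) (slice T l)
        (slice T (σ 0)) (slice T (σ 1)) (slice T (σ 2)) (slice T (σ 3)) := by
  have h : ∀ k, (genericSlice k).map (eval fun p => T p.1 p.2.1 p.2.2) = slice T k := by
    intro k; ext i j; simp [genericSlice, slice]
  simp only [evalTensor, lmPoly, map_mul, eval_C, map_sum, map_zsmul, map_sixForm, h]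

theorem restrictToBlock_lmPoly (k l : Fin 4) :
    restrictToBlock (lmPoly k l) = X (2, 2, k) * X (2, 2, l) * blockDet := by
  have h : ∀ k, (genericSlice k).map (restrictToBlock : CoordRing334 →+* CoordRing334) =
      blockMatrix ![X (0, 0, k), X (0, 1, k), X (1, 0, k), X (1, 1, k)] (X (2, 2, k)) := by
    intro k
    ext1 i j
    fin_cases i <;> fin_cases j <;> simp [genericSlice, blockMatrix, restrictToBlock]
  have hs : ∀ U V A B C D, restrictToBlock (sixForm U V A B C D) = _ :=
    map_sixForm (restrictToBlock : CoordRing334 →+* CoordRing334)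
  have hC : restrictToBlock (C (-1 / 18 : ℂ)) = C (-1 / 18) := restrictToBlock.commutes _
  have key := sum_sign_sixForm_blockMatrix (R := CoordRing334)
    (fun k => ![X (0, 0, k), X (0, 1, k), X (1, 0, k), X (1, 1, k)]) (fun k => X (2, 2, k)) k l
  simp only [lmPoly, map_mul, map_sum, map_zsmul, hs, h, hC, key]
  have h18 : (-18 : CoordRing334) = C (-18 : ℂ) := by
    rw [map_neg]
    exact congrArg Neg.neg (map_ofNat C 18).symm
  rw [h18, ← mul_assoc, ← C_mul]
  norm_num [blockDet]

theorem evalTensor_restrictToBlock {T : Tensor3 3 3 4} (hT : IsBlockTensor T) (P : CoordRing334) :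
    evalTensor T (restrictToBlock P) = evalTensor T P := by
  have : (aeval fun p : Fin 3 × Fin 3 × Fin 4 => T p.1 p.2.1 p.2.2).comp restrictToBlock =
      (aeval fun p : Fin 3 × Fin 3 × Fin 4 => T p.1 p.2.1 p.2.2) := by
    ext ⟨i, j, k⟩
    obtain ⟨h1, h2, h3, h4⟩ := hT k
    fin_cases i <;> fin_cases j <;> simp [restrictToBlock, *]
  have h := DFunLike.congr_fun this P
  simpa [evalTensor, aeval_eq_eval] using h

theorem evalTensor_lmPoly_of_isBlockTensor {T : Tensor3 3 3 4} (hT : IsBlockTensor T)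
    (k l : Fin 4) :
    evalTensor T (lmPoly k l) = T 2 2 k * T 2 2 l * evalTensor T blockDet := by
  rw [← evalTensor_restrictToBlock hT, restrictToBlock_lmPoly]
  simp [evalTensor]

/-- The `4 × 4` matrix whose `k`-th row lists the entries of the `k`-th `2 × 2` block. -/
def blockEntries (T : Tensor3 3 3 4) : Matrix (Fin 4) (Fin 4) ℂ :=
  Matrix.of fun k => ![T 0 0 k, T 0 1 k, T 1 0 k, T 1 1 k]

theorem evalTensor_blockDet (T : Tensor3 3 3 4) :
    evalTensor T blockDet = (blockEntries T).det := by
  rw [evalTensor, blockDet, RingHom.map_det]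
  congr 1
  ext k i
  fin_cases i <;> simp [blockEntries]

theorem not_linearIndependent_block_iff (T : Tensor3 3 3 4) :
    ¬ LinearIndependent ℂ (fun k : Fin 4 => block T k) ↔ evalTensor T blockDet = 0 := by
  rw [evalTensor_blockDet, ← Matrix.exists_vecMul_eq_zero_iff, Fintype.not_linearIndependent_iff]
  refine exists_congr fun g => ?_
  rw [and_comm, ← Function.ne_iff]
  refine and_congr Iff.rfl ?_
  simp only [funext_iff, ← Matrix.ext_iff, Fin.forall_fin_succ, Fin.sum_univ_four]
  simp [block, blockEntries, Matrix.vecMul, dotProduct, Fin.sum_univ_four, and_assoc]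

theorem blockDet_ne_zero : blockDet ≠ 0 := by
  intro h
  -- The blocks of this tensor are the four matrix units, so its `blockEntries` is the identity.
  have h1 := evalTensor_blockDet fun i j k => if (i, j, k) ∈ ({(0, 0, 0), (0, 1, 1), (1, 0, 2),
    (1, 1, 3)} : Finset (Fin 3 × Fin 3 × Fin 4)) then 1 else 0
  rw [h] at h1
  simp [blockEntries, evalTensor, det_fin_four] at h1

theorem linearIndependent_lmPoly :
    LinearIndependent ℂ
      (fun p : {p : Fin 4 × Fin 4 // p.1 ≤ p.2} => lmPoly p.1.1 p.1.2) := by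
  apply LinearIndependent.of_comp restrictToBlock.toLinearMap
  let m : {p : Fin 4 × Fin 4 // p.1 ≤ p.2} → (Fin 3 × Fin 3 × Fin 4 →₀ ℕ) := fun p =>
    Finsupp.single ((2, 2, p.1.1) : Fin 3 × Fin 3 × Fin 4) 1 +
      Finsupp.single ((2, 2, p.1.2) : Fin 3 × Fin 3 × Fin 4) 1
  have hinj : Function.Injective m := by
    intro p q h
    -- The exponent at `(2, 2, j)` counts how often `j` occurs in the pair, which determines an
    -- ordered pair.
    have h' : ∀ j : Fin 4, (if p.1.1 = j then 1 else 0) + (if p.1.2 = j then 1 else 0) =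
        (if q.1.1 = j then 1 else 0) + (if q.1.2 = j then 1 else 0) := by
      intro j
      simpa [m, Finsupp.single_apply] using DFunLike.congr_fun h (2, 2, j)
    clear h m
    revert p q
    decide
  have hm := ((basisMonomials (Fin 3 × Fin 3 × Fin 4) ℂ).linearIndependent.comp _ hinj).map'
    (LinearMap.mulRight ℂ blockDet) (LinearMap.ker_eq_bot.2 (mul_left_injective₀ blockDet_ne_zero))
  have e : (restrictToBlock.toLinearMap ∘
      fun p : {p : Fin 4 × Fin 4 // p.1 ≤ p.2} => lmPoly p.1.1 p.1.2) =
      LinearMap.mulRight ℂ blockDet ∘ basisMonomials (Fin 3 × Fin 3 × Fin 4) ℂ ∘ m := by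
    funext p
    simp [restrictToBlock_lmPoly, X, monomial_mul, m]
  rw [e]
  exact hm

/-! ### Vanishing on tensors of rank at most four -/

theorem sixForm_vecMulVec {R : Type*} [CommRing R] (u v a b c d u' v' a' b' c' d' : Fin 3 → R) :
    sixForm (Matrix.vecMulVec u u') (Matrix.vecMulVec v v') (Matrix.vecMulVec a a')
      (Matrix.vecMulVec b b') (Matrix.vecMulVec c c') (Matrix.vecMulVec d d') =
      altSum (fun i j k => u i * a j * b k) * altSum (fun i j k => v i * c j * d k) *
        altSum (fun i j k => u' i * a' j * c' k) * altSum (fun i j k => v' i * b' j * d' k) := by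
  simp only [← sum_perm_fin_three]
  rw [Finset.sum_mul_sum, Finset.sum_mul, Finset.sum_mul]
  refine Finset.sum_congr rfl fun α _ => ?_
  rw [Finset.sum_mul, Finset.sum_mul]
  refine Finset.sum_congr rfl fun β _ => ?_
  rw [mul_assoc, Finset.sum_mul_sum, Finset.mul_sum]
  refine Finset.sum_congr rfl fun γ _ => ?_
  rw [Finset.mul_sum]
  refine Finset.sum_congr rfl fun δ _ => ?_
  simp only [Matrix.vecMulVec_apply, zsmul_eq_mul, Units.val_mul, Int.cast_mul]
  ring

/-- `sixForm` as a linear form in its first argument. -/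
def sixFormLeft {R : Type*} [CommRing R] (V A B C D : Matrix (Fin 3) (Fin 3) R) :
    Matrix (Fin 3) (Fin 3) R →ₗ[R] R where
  toFun U := sixForm U V A B C D
  map_add' U U' := by
    simp only [sixForm, ← Finset.sum_add_distrib, ← smul_add, Matrix.add_apply, add_mul]
  map_smul' r U := by
    simp only [sixForm, Finset.smul_sum, Matrix.smul_apply, smul_mul_assoc, smul_comm r,
      RingHom.id_apply]

/-- `sixForm` as a linear form in its second argument. -/
def sixFormRight {R : Type*} [CommRing R] (U A B C D : Matrix (Fin 3) (Fin 3) R) :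
    Matrix (Fin 3) (Fin 3) R →ₗ[R] R where
  toFun V := sixForm U V A B C D
  map_add' V V' := by
    simp only [sixForm, ← Finset.sum_add_distrib, ← smul_add, Matrix.add_apply, add_mul, mul_add]
  map_smul' r V := by
    simp only [sixForm, Finset.smul_sum, Matrix.smul_apply, smul_mul_assoc, mul_smul_comm,
      smul_comm r, RingHom.id_apply]

theorem sixForm_sum {R ι : Type*} [CommRing R] [Fintype ι] (c d : ι → R)
    (M : ι → Matrix (Fin 3) (Fin 3) R) (A B C D : Matrix (Fin 3) (Fin 3) R) :
    sixForm (∑ s, c s • M s) (∑ s, d s • M s) A B C D =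
      ∑ p, ∑ q, c p * d q * sixForm (M p) (M q) A B C D := by
  change sixFormLeft _ A B C D _ = _
  simp only [map_sum, map_smul]
  refine Finset.sum_congr rfl fun p _ => ?_
  change c p • sixFormRight (M p) A B C D _ = _
  simp only [map_sum, map_smul, smul_eq_mul]
  rw [Finset.mul_sum]
  exact Finset.sum_congr rfl fun q _ => (mul_assoc _ _ _).symm

theorem sum_sign_sixForm_eq_det_mul {R : Type*} [CommRing R] (c : Matrix (Fin 4) (Fin 4) R)
    (M : Fin 4 → Matrix (Fin 3) (Fin 3) R) (U V : Matrix (Fin 3) (Fin 3) R) :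
    ∑ σ : Equiv.Perm (Fin 4), ((σ.sign : ℤˣ) : ℤ) •
      sixForm U V (∑ s, c (σ 0) s • M s) (∑ s, c (σ 1) s • M s) (∑ s, c (σ 2) s • M s)
        (∑ s, c (σ 3) s • M s) =
      c.det * ∑ σ : Equiv.Perm (Fin 4), ((σ.sign : ℤˣ) : ℤ) •
        sixForm U V (M (σ 0)) (M (σ 1)) (M (σ 2)) (M (σ 3)) := by
  have key : ∀ e : Fin 4 → Fin 3 × Fin 3,
      ∑ σ : Equiv.Perm (Fin 4), ((σ.sign : ℤˣ) : ℤ) •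
        ∏ m, (∑ s, c (σ m) s • M s) (e m).1 (e m).2 =
      c.det * ∑ σ : Equiv.Perm (Fin 4), ((σ.sign : ℤˣ) : ℤ) • ∏ m, M (σ m) (e m).1 (e m).2 := by
    intro e
    -- For fixed entry positions `e`, both alternating sums are determinants, and the coefficients
    -- enter as a matrix product.
    have h := Matrix.det_mul c (Matrix.of fun s m => M s (e m).1 (e m).2)
    rw [Matrix.det_apply, Matrix.det_apply (Matrix.of _)] at h
    simpa [Matrix.mul_apply, Matrix.sum_apply, Units.smul_def] using h
  have swap : ∀ N : Fin 4 → Matrix (Fin 3) (Fin 3) R,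
      ∑ σ : Equiv.Perm (Fin 4), ((σ.sign : ℤˣ) : ℤ) •
        sixForm U V (N (σ 0)) (N (σ 1)) (N (σ 2)) (N (σ 3)) =
      ∑ α : Equiv.Perm (Fin 3), ∑ β : Equiv.Perm (Fin 3),
      ∑ γ : Equiv.Perm (Fin 3), ∑ δ : Equiv.Perm (Fin 3),
        ((α.sign * β.sign * γ.sign * δ.sign : ℤˣ) : ℤ) • (U (α 0) (γ 0) * V (β 0) (δ 0) *
          ∑ σ : Equiv.Perm (Fin 4), ((σ.sign : ℤˣ) : ℤ) • ∏ m, N (σ m)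
            ((![(α 1, γ 1), (α 2, δ 1), (β 1, γ 2), (β 2, δ 2)] : Fin 4 → Fin 3 × Fin 3) m).1
            ((![(α 1, γ 1), (α 2, δ 1), (β 1, γ 2), (β 2, δ 2)] : Fin 4 → Fin 3 × Fin 3) m).2) := by
    intro N
    simp only [sixForm, Finset.smul_sum, Finset.mul_sum]
    rw [Finset.sum_comm]
    refine Finset.sum_congr rfl fun α _ => ?_
    rw [Finset.sum_comm]
    refine Finset.sum_congr rfl fun β _ => ?_
    rw [Finset.sum_comm]
    refine Finset.sum_congr rfl fun γ _ => ?_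
    rw [Finset.sum_comm]
    refine Finset.sum_congr rfl fun δ _ => Finset.sum_congr rfl fun σ _ => ?_
    simp only [Fin.prod_univ_four, Matrix.cons_val, zsmul_eq_mul]
    ring
  rw [swap fun k => ∑ s, c k s • M s, swap M]
  rw [Finset.mul_sum]
  refine Finset.sum_congr rfl fun α _ => ?_
  rw [Finset.mul_sum]
  refine Finset.sum_congr rfl fun β _ => ?_
  rw [Finset.mul_sum]
  refine Finset.sum_congr rfl fun γ _ => ?_
  rw [Finset.mul_sum]
  refine Finset.sum_congr rfl fun δ _ => ?_
  rw [key, mul_smul_comm, mul_left_comm c.det]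

theorem sum_sign_sixForm_vecMulVec (a b : Fin 4 → Fin 3 → ℂ) (p q : Fin 4) :
    ∑ σ : Equiv.Perm (Fin 4), ((σ.sign : ℤˣ) : ℤ) •
      sixForm (Matrix.vecMulVec (a p) (b p)) (Matrix.vecMulVec (a q) (b q))
        (Matrix.vecMulVec (a (σ 0)) (b (σ 0))) (Matrix.vecMulVec (a (σ 1)) (b (σ 1)))
        (Matrix.vecMulVec (a (σ 2)) (b (σ 2))) (Matrix.vecMulVec (a (σ 3)) (b (σ 3))) = 0 := by
  let D : (Fin 3 → ℂ) → (Fin 3 → ℂ) → (Fin 3 → ℂ) → ℂ := fun x y z =>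
    altSum fun i j k => x i * y j * z k
  have D1 : ∀ x y, D x x y = 0 := fun x y => by simp only [D, altSum]; ring
  have D2 : ∀ x y, D x y x = 0 := fun x y => by simp only [D, altSum]; ring
  have Dc : ∀ x y z, D x y z = D z x y := fun x y z => by simp only [D, altSum]; ring
  let F : Equiv.Perm (Fin 4) → ℂ := fun σ =>
    D (a p) (a (σ 0)) (a (σ 1)) * D (a q) (a (σ 2)) (a (σ 3)) *
      D (b p) (b (σ 0)) (b (σ 2)) * D (b q) (b (σ 1)) (b (σ 3))
  have hF : ∀ σ, F (σ * Equiv.swap 1 2) = F σ := by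
    intro σ
    have e0 : (σ * Equiv.swap 1 2 : Equiv.Perm (Fin 4)) 0 = σ 0 := rfl
    have e1 : (σ * Equiv.swap 1 2 : Equiv.Perm (Fin 4)) 1 = σ 2 := rfl
    have e2 : (σ * Equiv.swap 1 2 : Equiv.Perm (Fin 4)) 2 = σ 1 := rfl
    have e3 : (σ * Equiv.swap 1 2 : Equiv.Perm (Fin 4)) 3 = σ 3 := rfl
    obtain ⟨i, rfl⟩ := σ.surjective p
    obtain ⟨j, rfl⟩ := σ.surjective q
    simp only [F, e0, e1, e2, e3]
    -- With `p = σ i` and `q = σ j`, a determinant has a repeated vector unless `i = 3` and `j = 0`.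
    -- In that case the transposition only permutes the four factors, up to cyclic shifts of their
    -- arguments.
    fin_cases i <;> fin_cases j <;>
      simp only [Fin.zero_eta, Fin.mk_one, Fin.reduceFinMk, D1, D2, mul_zero, zero_mul]
    rw [Dc (a (σ 0)) (a (σ 1)), Dc (a (σ 0)) (a (σ 2)), Dc (b (σ 0)) (b (σ 1)),
      Dc (b (σ 0)) (b (σ 2))]
    ring
  simp only [sixForm_vecMulVec]
  change ∑ σ : Equiv.Perm (Fin 4), ((σ.sign : ℤˣ) : ℤ) • F σ = 0
  have h := Equiv.sum_comp (Equiv.mulRight (Equiv.swap (1 : Fin 4) 2))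
    fun σ : Equiv.Perm (Fin 4) => ((σ.sign : ℤˣ) : ℤ) • F σ
  have hs : Equiv.Perm.sign (Equiv.swap (1 : Fin 4) 2) = -1 := by decide
  simp only [Equiv.coe_mulRight, hF, Equiv.Perm.sign_mul, hs, mul_neg, mul_one, Units.val_neg,
    neg_smul, Finset.sum_neg_distrib] at h
  exact self_eq_neg.1 h.symm

theorem sum_sign_sixForm_eq_zero_of_rank (a b : Fin 4 → Fin 3 → ℂ) (c : Matrix (Fin 4) (Fin 4) ℂ)
    (k l : Fin 4) (S : Fin 4 → Matrix (Fin 3) (Fin 3) ℂ)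
    (hS : ∀ k, S k = ∑ s, c k s • Matrix.vecMulVec (a s) (b s)) :
    ∑ σ : Equiv.Perm (Fin 4), ((σ.sign : ℤˣ) : ℤ) •
      sixForm (S k) (S l) (S (σ 0)) (S (σ 1)) (S (σ 2)) (S (σ 3)) = 0 := by
  simp only [hS]
  rw [sum_sign_sixForm_eq_det_mul c fun s => Matrix.vecMulVec (a s) (b s)]
  simp only [sixForm_sum, Finset.smul_sum]
  rw [Finset.sum_comm, Finset.sum_eq_zero, mul_zero]
  intro p _
  rw [Finset.sum_comm, Finset.sum_eq_zero]
  intro q _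
  simp only [← mul_smul_comm _ (c k p * c l q)]
  rw [← Finset.mul_sum, sum_sign_sixForm_vecMulVec, mul_zero]

theorem evalTensor_lmPoly_eq_zero_of_hasRankLE {T : Tensor3 3 3 4} (hT : HasRankLE 4 T)
    (k l : Fin 4) : evalTensor T (lmPoly k l) = 0 := by
  obtain ⟨a, b, c, h⟩ := hT
  rw [evalTensor_lmPoly, sum_sign_sixForm_eq_zero_of_rank a b (Matrix.of fun k s => c s k) k l
    (slice T), mul_zero]
  intro k
  ext i j
  simp only [slice, Matrix.of_apply, h, Matrix.sum_apply, Matrix.smul_apply,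
    Matrix.vecMulVec_apply, smul_eq_mul]
  exact Finset.sum_congr rfl fun s _ => mul_comm _ _

theorem continuous_evalTensor (P : CoordRing334) : Continuous fun T => evalTensor T P :=
  (MvPolynomial.continuous_eval P).comp (by fun_prop)

theorem evalTensor_lmPoly_eq_zero_of_mem {T : Tensor3 3 3 4} (hT : T ∈ borderRankVariety 4 3 3 4)
    (k l : Fin 4) : evalTensor T (lmPoly k l) = 0 :=
  closure_minimal (t := {T | evalTensor T (lmPoly k l) = 0})
    (fun _ h => evalTensor_lmPoly_eq_zero_of_hasRankLE h k l)
    (isClosed_eq (continuous_evalTensor _) continuous_const) hT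

/-! ### Block tensors of rank at most four -/

theorem HasRankLE.of_reindex {m n l r : ℕ} {T : Tensor3 m n l} (π : Equiv.Perm (Fin m))
    (ρ : Equiv.Perm (Fin n)) (h : HasRankLE r fun i j k => T (π i) (ρ j) k) : HasRankLE r T := by
  obtain ⟨a, b, c, h⟩ := h
  refine ⟨fun s i => a s (π.symm i), fun s j => b s (ρ.symm j), c, fun i j k => ?_⟩
  simpa using h (π.symm i) (ρ.symm j) k

theorem hasRankLE_four_of_corner_eq_zero {T : Tensor3 3 3 4} (hT : IsBlockTensor T)
    (h : ∀ k, T 2 2 k = 0) : HasRankLE 4 T := by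
  refine ⟨![![1, 0, 0], ![1, 0, 0], ![0, 1, 0], ![0, 1, 0]],
    ![![1, 0, 0], ![0, 1, 0], ![1, 0, 0], ![0, 1, 0]], ![T 0 0, T 0 1, T 1 0, T 1 1], ?_⟩
  intro i j k
  obtain ⟨h1, h2, h3, h4⟩ := hT k
  fin_cases i <;> fin_cases j <;> simp [Fin.sum_univ_four, *]

theorem hasRankLE_four_of_eq {T : Tensor3 3 3 4} (hT : IsBlockTensor T) (t u w : ℂ)
    (h : ∀ k, T 0 0 k = -(t * T 0 1 k + u * T 1 0 k + w * T 1 1 k)) : HasRankLE 4 T := by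
  -- The first three matrices satisfy the equation `h` of the hyperplane. In the third, the left
  -- vector `(1 - u, 1)` makes the equation for the first entry `s` of the right vector `(s, 1)`
  -- solvable without division: `s = t * u - w - t`.
  refine ⟨![![1, 0, 0], ![-u, 1, 0], ![1 - u, 1, 0], ![0, 0, 1]],
    ![![-t, 1, 0], ![1, 0, 0], ![t * u - w - t, 1, 0], ![0, 0, 1]],
    ![fun k => T 0 1 k - (1 - u) * T 1 1 k, fun k => T 1 0 k - (t * u - w - t) * T 1 1 k,
      T 1 1, T 2 2], ?_⟩
  intro i j k
  obtain ⟨h1, h2, h3, h4⟩ := hT k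
  fin_cases i <;> fin_cases j <;> simp [Fin.sum_univ_four, h, h1, h2, h3, h4]
  ring

theorem hasRankLE_four_of_evalTensor_blockDet_eq_zero {T : Tensor3 3 3 4} (hT : IsBlockTensor T)
    (h : evalTensor T blockDet = 0) : HasRankLE 4 T := by
  rw [evalTensor_blockDet, ← Matrix.exists_mulVec_eq_zero_iff] at h
  -- A right kernel vector is one linear equation satisfied by all blocks. Row and column swaps move
  -- a nonzero coefficient to the entry `(0, 0)`.
  obtain ⟨n, hn, h⟩ := h
  have h' : ∀ k, T 0 0 k * n 0 + T 0 1 k * n 1 + T 1 0 k * n 2 + T 1 1 k * n 3 = 0 := by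
    intro k
    simpa [Matrix.mulVec, dotProduct, Fin.sum_univ_four, blockEntries] using congrFun h k
  have s0 : Equiv.swap (0 : Fin 3) 1 0 = 1 := by decide
  have s1 : Equiv.swap (0 : Fin 3) 1 1 = 0 := by decide
  have s2 : Equiv.swap (0 : Fin 3) 1 2 = 2 := by decide
  obtain ⟨i, hi⟩ := Function.ne_iff.1 hn
  have aux : ∀ (π ρ : Equiv.Perm (Fin 3)), (π = 1 ∨ π = Equiv.swap 0 1) →
      (ρ = 1 ∨ ρ = Equiv.swap 0 1) → ∀ t u w : ℂ,
      (∀ k, T (π 0) (ρ 0) k =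
        -(t * T (π 0) (ρ 1) k + u * T (π 1) (ρ 0) k + w * T (π 1) (ρ 1) k)) → HasRankLE 4 T := by
    intro π ρ hπ hρ t u w hk
    refine HasRankLE.of_reindex π ρ (hasRankLE_four_of_eq ?_ t u w hk)
    intro k
    obtain ⟨h1, h2, h3, h4⟩ := hT k
    rcases hπ with rfl | rfl <;> rcases hρ with rfl | rfl <;> simp [*]
  fin_cases i <;> simp only [Fin.zero_eta, Fin.mk_one, Fin.reduceFinMk, Pi.zero_apply] at hi
  · refine aux 1 1 (.inl rfl) (.inl rfl) (n 1 / n 0) (n 2 / n 0) (n 3 / n 0) fun k => ?_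
    simp only [Equiv.Perm.one_apply]
    field_simp
    linear_combination h' k
  · refine aux 1 (.swap 0 1) (.inl rfl) (.inr rfl) (n 0 / n 1) (n 3 / n 1) (n 2 / n 1) fun k => ?_
    simp only [Equiv.Perm.one_apply, s0, s1]
    field_simp
    linear_combination h' k
  · refine aux (.swap 0 1) 1 (.inr rfl) (.inl rfl) (n 3 / n 2) (n 0 / n 2) (n 1 / n 2) fun k => ?_
    simp only [Equiv.Perm.one_apply, s0, s1]
    field_simp
    linear_combination h' k
  · refine aux (.swap 0 1) (.swap 0 1) (.inr rfl) (.inr rfl) (n 2 / n 3) (n 1 / n 3) (n 0 / n 3)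
      fun k => ?_
    simp only [s0, s1]
    field_simp
    linear_combination h' k

/-! ### The equivalences for block tensors -/

theorem corner_mul_blockDet_eq_zero_iff (T : Tensor3 3 3 4) :
    (∀ k l : Fin 4, k ≤ l → T 2 2 k * T 2 2 l * evalTensor T blockDet = 0) ↔
      evalTensor T blockDet = 0 ∨ ∀ k : Fin 4, T 2 2 k = 0 := by
  refine ⟨fun h => or_iff_not_imp_left.2 fun h0 k => ?_, ?_⟩
  · simpa [h0] using h k k le_rfl
  · rintro (h | h) k l - <;> simp [h]

theorem mem_borderRankVariety_iff_of_isBlockTensor {T : Tensor3 3 3 4} (hT : IsBlockTensor T) :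
    T ∈ borderRankVariety 4 3 3 4 ↔
      ∀ k l : Fin 4, k ≤ l → T 2 2 k * T 2 2 l * evalTensor T blockDet = 0 := by
  refine ⟨fun h k l _ => ?_, fun h => subset_closure ?_⟩
  · rw [← evalTensor_lmPoly_of_isBlockTensor hT]
    exact evalTensor_lmPoly_eq_zero_of_mem h k l
  · rcases (corner_mul_blockDet_eq_zero_iff T).1 h with h | h
    · exact hasRankLE_four_of_evalTensor_blockDet_eq_zero hT h
    · exact hasRankLE_four_of_corner_eq_zero hT h

theorem mainTheorem4 :
    -- ten linearly independent forms of degree six that vanish on `V_4(3,3,4)`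
    Fintype.card {p : Fin 4 × Fin 4 // p.1 ≤ p.2} = 10 ∧
    LinearIndependent ℂ (fun p : {p : Fin 4 × Fin 4 // p.1 ≤ p.2} => lmPoly p.1.1 p.1.2) ∧
    (∀ k l : Fin 4, (lmPoly k l).IsHomogeneous 6) ∧
    (∀ T ∈ borderRankVariety 4 3 3 4, ∀ k l : Fin 4, k ≤ l → evalTensor T (lmPoly k l) = 0) ∧
    -- their restrictions to block tensors
    (∀ k l : Fin 4, k ≤ l →
      restrictToBlock (lmPoly k l) =
        MvPolynomial.X (2, 2, k) * MvPolynomial.X (2, 2, l) * blockDet) ∧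
    -- the characterisations of border rank at most four for block tensors
    (∀ T : Tensor3 3 3 4, IsBlockTensor T →
      (T ∈ borderRankVariety 4 3 3 4 ↔
        ∀ k l : Fin 4, k ≤ l → evalTensor T (lmPoly k l) = 0) ∧
      (T ∈ borderRankVariety 4 3 3 4 ↔
        ∀ k l : Fin 4, k ≤ l → T 2 2 k * T 2 2 l * evalTensor T blockDet = 0) ∧
      (T ∈ borderRankVariety 4 3 3 4 ↔
        ¬ LinearIndependent ℂ (fun k : Fin 4 => block T k) ∨ ∀ k : Fin 4, T 2 2 k = 0) ∧
      (¬ LinearIndependent ℂ (fun k : Fin 4 => block T k) ↔ evalTensor T blockDet = 0)) := by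
  refine ⟨by decide, linearIndependent_lmPoly, isHomogeneous_lmPoly,
    fun T hT k l _ => evalTensor_lmPoly_eq_zero_of_mem hT k l,
    fun k l _ => restrictToBlock_lmPoly k l, fun T hT => ⟨?_, ?_, ?_, ?_⟩⟩
  · simp only [mem_borderRankVariety_iff_of_isBlockTensor hT,
      evalTensor_lmPoly_of_isBlockTensor hT]
  · exact mem_borderRankVariety_iff_of_isBlockTensor hT
  · rw [mem_borderRankVariety_iff_of_isBlockTensor hT, corner_mul_blockDet_eq_zero_iff,
      not_linearIndependent_block_iff]
  · exact not_linearIndependent_block_iff T
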